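/- Let $f(x)=1+x+x^2$. For $m\ge 0$ call a string of $m$ digits in $\mathbb{Z}/2$ an accessible $m$-block if, for some $k\ge 0$, it occurs as a string of $m$ consecutive entries in the sequence of coefficients, ordered by powers of $x$, of $f(x)^k$ reduced modulo $2$. Let $a(m)$ be the number of accessible $m$-blocks (so $a(0)=1$, the empty block), and let $g(z)=\sum_{m\ge 0}a(m)z^m$ be the generating function, a formal power series. Then $$g(z)=\frac{1+2z^3+2z^5-z^6+z^3\sum_{i=0}^{\infty}\left(z^{2^i}-z^{3\cdot 2^i}\right)}{(1-z^2)(1-z)^2},$$ where the infinite sum converges in the ring of formal power series. -/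

import Mathlib

open scoped PowerSeries.WithPiTopology

/-- Row `k` for the integer polynomial `f` modulo `p`: the power `f ^ k`, with its coefficients
reduced modulo `p`. -/
noncomputable def blockRow (f : Polynomial ℤ) (p k : ℕ) : Polynomial (ZMod p) :=
  (f.map (Int.castRingHom (ZMod p))) ^ k

/-- The `m`-block `w` (a string of `m` digits modulo `p`) is accessible for `f` and `p`: it occurs
as a string of consecutive entries in the list of coefficients (of `x ^ 0, x ^ 1, …, x ^ d`, where
`d` is the degree) of some power of `f` modulo `p`. -/
def IsAccessibleBlock (f : Polynomial ℤ) (p : ℕ) {m : ℕ} (w : Fin m → ZMod p) : Prop :=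
  ∃ k i : ℕ, i + m ≤ (blockRow f p k).natDegree + 1 ∧
    ∀ j : Fin m, w j = (blockRow f p k).coeff (i + j)

/-- The number of accessible `m`-blocks for `f` and `p`. The empty block is accessible, so
this number is `1` for `m = 0`. -/
noncomputable def accessibleCount (f : Polynomial ℤ) (p m : ℕ) : ℕ :=
  Set.ncard {w : Fin m → ZMod p | IsAccessibleBlock f p w}

/-- The generating function of the numbers of accessible blocks, as a formal power series. -/
noncomputable def accessibleGenFun (f : Polynomial ℤ) (p : ℕ) : PowerSeries ℚ :=
  PowerSeries.mk fun m => (accessibleCount f p m : ℚ)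

/-!
The proof is a recursion for the number `a m` of accessible blocks of length `m`, obtained from the
self-similarity of the rows. Write `f = 1 + x + x ^ 2`. Modulo `2` one has `(f ^ k) (x) ^ 2 =
(f ^ k) (x ^ 2)`, so row `2 * k` is row `k` interlaced with zeros, and row `2 * k + 1` has the
entries of row `k` at the odd positions and the sums of two neighbouring entries of row `k` at the
even positions. Since large powers contain each row between long runs of zeros
(`isAccessibleBlock_iff`), rows may be extended by zeros in both directions, and every block of
length `m` comes from a block of about half the length in one of four ways, according to the
parities of the row and of the starting position (`blockSet_eq_union`). Each way is injective, and
for `m ≥ 6` the overlaps are explicit: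

* the two kinds in even rows share only the zero block (`evenRow_inter`);
* the two kinds in odd rows share the four initial parts of solutions of the Fibonacci recursion
  modulo `2` (`oddRow_inter`);
* even and odd rows share `0…0`, `10…0` and `0…01` (`evenRow_inter_oddRow`); here one uses that
  `1111` and `10…01` with an even positive number of zeros are not accessible.

Inclusion–exclusion gives `a (2 n) = 2 a n + 2 a (n + 1) - 8` and
`a (2 n + 1) = a n + 2 a (n + 1) + a (n + 2) - 8` for `n ≥ 3` (`ncard_blockSet_add_eight`). For the
coefficients `a (m + 4) - 2 a (m + 3) + 2 a (m + 1) - a m` of `(1 - z ^ 2) (1 - z) ^ 2 g` this means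
that they vanish for even `m ≥ 6`, and that the one of index `2 n + 1` equals the one of index `n`.
The coefficients of the lacunary series satisfy the same recursion
(`blockDifference_eq_lacunaryCoeff`), and the values `a 0, …, a 5 = 1, 2, 4, 8, 14, 25` settle the
rest.
-/

/-! ### Rows of coefficients, extended by zeros to the left and right -/

/-- The coefficient of `x ^ t` in a polynomial, for an integer `t`; it is `0` for negative `t`. -/
noncomputable def intCoeff (P : Polynomial (ZMod 2)) (t : ℤ) : ZMod 2 :=
  if 0 ≤ t then P.coeff t.toNat else 0

/-- The coefficients of `(1 + x + x ^ 2) ^ k` modulo `2`, indexed by all integers. -/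
noncomputable def trinomialRow (k : ℕ) (t : ℤ) : ZMod 2 :=
  intCoeff ((1 + Polynomial.X + Polynomial.X ^ 2) ^ k) t

lemma intCoeff_natCast (P : Polynomial (ZMod 2)) (n : ℕ) : intCoeff P n = P.coeff n := by
  simp [intCoeff]

lemma intCoeff_of_neg (P : Polynomial (ZMod 2)) {t : ℤ} (ht : t < 0) : intCoeff P t = 0 := by
  simp [intCoeff, not_le.mpr ht]

lemma intCoeff_add (P Q : Polynomial (ZMod 2)) (t : ℤ) :
    intCoeff (P + Q) t = intCoeff P t + intCoeff Q t := by
  unfold intCoeff; split_ifs <;> simp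

lemma intCoeff_X_pow_mul (P : Polynomial (ZMod 2)) (s : ℕ) (t : ℤ) :
    intCoeff (Polynomial.X ^ s * P) t = intCoeff P (t - s) := by
  rcases lt_or_ge t 0 with ht | ht
  · rw [intCoeff_of_neg _ ht, intCoeff_of_neg _ (by omega)]
  · lift t to ℕ using ht
    rw [intCoeff_natCast, Polynomial.coeff_X_pow_mul']
    split_ifs with h
    · rw [← Nat.cast_sub h, intCoeff_natCast]
    · rw [intCoeff_of_neg _ (by omega)]

lemma intCoeff_sq_two_mul (P : Polynomial (ZMod 2)) (t : ℤ) :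
    intCoeff (P ^ 2) (2 * t) = intCoeff P t := by
  rcases lt_or_ge t 0 with ht | ht
  · rw [intCoeff_of_neg _ ht, intCoeff_of_neg _ (by omega)]
  · lift t to ℕ using ht
    rw [← ZMod.expand_card, show (2 * (t : ℤ)) = ((2 * t : ℕ) : ℤ) by push_cast; ring,
      intCoeff_natCast, intCoeff_natCast, Polynomial.coeff_expand two_pos]
    simp

lemma intCoeff_sq_two_mul_add_one (P : Polynomial (ZMod 2)) (t : ℤ) :
    intCoeff (P ^ 2) (2 * t + 1) = 0 := by
  rcases lt_or_ge t 0 with ht | ht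
  · rw [intCoeff_of_neg _ (by omega)]
  · lift t to ℕ using ht
    rw [← ZMod.expand_card, show (2 * (t : ℤ) + 1) = ((2 * t + 1 : ℕ) : ℤ) by push_cast; ring,
      intCoeff_natCast, Polynomial.coeff_expand two_pos, if_neg (by omega)]

lemma trinomialRow_even_even (k : ℕ) (t : ℤ) :
    trinomialRow (2 * k) (2 * t) = trinomialRow k t := by
  rw [trinomialRow, mul_comm 2 k, pow_mul, intCoeff_sq_two_mul, trinomialRow]

lemma trinomialRow_even_odd (k : ℕ) (t : ℤ) : trinomialRow (2 * k) (2 * t + 1) = 0 := by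
  rw [trinomialRow, mul_comm 2 k, pow_mul, intCoeff_sq_two_mul_add_one]

lemma trinomialRow_odd (k : ℕ) (t : ℤ) :
    trinomialRow (2 * k + 1) t =
      trinomialRow (2 * k) t + trinomialRow (2 * k) (t - 1) + trinomialRow (2 * k) (t - 2) := by
  have h : ((1 : Polynomial (ZMod 2)) + Polynomial.X + Polynomial.X ^ 2) ^ (2 * k + 1) =
      (1 + Polynomial.X + Polynomial.X ^ 2) ^ (2 * k) +
      Polynomial.X ^ 1 * (1 + Polynomial.X + Polynomial.X ^ 2) ^ (2 * k) +
      Polynomial.X ^ 2 * (1 + Polynomial.X + Polynomial.X ^ 2) ^ (2 * k) := by ring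
  rw [trinomialRow, h, intCoeff_add, intCoeff_add, intCoeff_X_pow_mul, intCoeff_X_pow_mul]
  simp [trinomialRow]

lemma trinomialRow_odd_even (k : ℕ) (t : ℤ) :
    trinomialRow (2 * k + 1) (2 * t) = trinomialRow k t + trinomialRow k (t - 1) := by
  rw [trinomialRow_odd, show 2 * t - 1 = 2 * (t - 1) + 1 by ring,
    show 2 * t - 2 = 2 * (t - 1) by ring, trinomialRow_even_even, trinomialRow_even_even,
    trinomialRow_even_odd, add_zero]

lemma trinomialRow_odd_odd (k : ℕ) (t : ℤ) :
    trinomialRow (2 * k + 1) (2 * t + 1) = trinomialRow k t := by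
  rw [trinomialRow_odd, show 2 * t + 1 - 1 = 2 * t by ring,
    show 2 * t + 1 - 2 = 2 * (t - 1) + 1 by ring, trinomialRow_even_even, trinomialRow_even_odd,
    trinomialRow_even_odd, add_zero, zero_add]

lemma trinomialRow_zero (t : ℤ) : trinomialRow 0 t = if t = 0 then 1 else 0 := by
  rcases lt_or_ge t 0 with ht | ht
  · rw [trinomialRow, intCoeff_of_neg _ ht, if_neg (by omega)]
  · lift t to ℕ using ht
    rw [trinomialRow, intCoeff_natCast, pow_zero, Polynomial.coeff_one]
    simp

lemma natDegree_trinomial :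
    (1 + Polynomial.X + Polynomial.X ^ 2 : Polynomial (ZMod 2)).natDegree = 2 := by
  compute_degree!

lemma blockRow_trinomial (k : ℕ) :
    blockRow (1 + Polynomial.X + Polynomial.X ^ 2) 2 k =
      (1 + Polynomial.X + Polynomial.X ^ 2) ^ k := by
  simp [blockRow]

lemma trinomialRow_of_two_mul_lt {k : ℕ} {t : ℤ} (h : 2 * (k : ℤ) < t) :
    trinomialRow k t = 0 := by
  lift t to ℕ using by omega
  rw [trinomialRow, intCoeff_natCast]
  apply Polynomial.coeff_eq_zero_of_natDegree_lt
  rw [Polynomial.natDegree_pow, natDegree_trinomial]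
  omega

lemma trinomialRow_add_two_pow (k n : ℕ) (t : ℤ) :
    trinomialRow (k + 2 ^ n) t =
      trinomialRow k t + trinomialRow k (t - 2 ^ n) + trinomialRow k (t - 2 * 2 ^ n) := by
  have h : ((1 : Polynomial (ZMod 2)) + Polynomial.X + Polynomial.X ^ 2) ^ (k + 2 ^ n) =
      (1 + Polynomial.X + Polynomial.X ^ 2) ^ k +
      Polynomial.X ^ (2 ^ n) * (1 + Polynomial.X + Polynomial.X ^ 2) ^ k +
      Polynomial.X ^ (2 * 2 ^ n) * (1 + Polynomial.X + Polynomial.X ^ 2) ^ k := by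
    rw [pow_add, add_pow_char_pow, add_pow_char_pow, one_pow, ← pow_mul]
    ring
  rw [trinomialRow, h, intCoeff_add, intCoeff_add, intCoeff_X_pow_mul, intCoeff_X_pow_mul]
  simp [trinomialRow]

/-! ### Blocks as truncated windows -/

/-- The sequence that agrees with `s` at the first `m` places and is `0` from there on. -/
def truncSeq (m : ℕ) (s : ℕ → ZMod 2) (j : ℕ) : ZMod 2 := if j < m then s j else 0

/-- The part of row `k` to the right of position `i`, read as a sequence. -/
noncomputable def rowWindow (k : ℕ) (i : ℤ) (j : ℕ) : ZMod 2 := trinomialRow k (i + j)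

/-- The blocks of length `m` in the rows extended by zeros; a block is encoded as a sequence that
vanishes from index `m` on. -/
def blockSet (m : ℕ) : Set (ℕ → ZMod 2) := {w | ∃ k i, w = truncSeq m (rowWindow k i)}

/-- Since `f ^ (k + 2 ^ n) = f ^ k + x ^ (2 ^ n) * f ^ k + x ^ (2 * 2 ^ n) * f ^ k`, for large `n`
the middle copy of row `k` in row `k + 2 ^ n` is surrounded by long runs of zeros. Hence reading
beyond the ends of a row produces no new blocks. -/
lemma isAccessibleBlock_iff {m : ℕ} (w : Fin m → ZMod 2) :
    IsAccessibleBlock (1 + Polynomial.X + Polynomial.X ^ 2) 2 w ↔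
      ∃ k i, ∀ j : Fin m, w j = rowWindow k i j := by
  constructor
  · rintro ⟨k, i, -, h⟩
    refine ⟨k, i, fun j => ?_⟩
    rw [h j, blockRow_trinomial, rowWindow, trinomialRow, ← Nat.cast_add, intCoeff_natCast]
  · rintro ⟨k, i, h⟩
    obtain ⟨n, hn⟩ : ∃ n : ℕ, 2 * k + i.natAbs + m + 1 < 2 ^ n := ⟨_, Nat.lt_two_pow_self⟩
    have hz : (2 * k + i.natAbs + m + 1 : ℤ) < 2 ^ n := by exact_mod_cast hn
    obtain ⟨s, hs⟩ : ∃ s : ℕ, (s : ℤ) = 2 ^ n + i := ⟨(2 ^ n + i).toNat, by omega⟩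
    refine ⟨k + 2 ^ n, s, ?_, fun j => ?_⟩
    · rw [blockRow_trinomial, Polynomial.natDegree_pow, natDegree_trinomial]
      have : ((2 ^ n : ℕ) : ℤ) = 2 ^ n := by push_cast; rfl
      omega
    · have hj := j.2
      rw [h j, blockRow_trinomial, ← intCoeff_natCast, ← trinomialRow, trinomialRow_add_two_pow,
        trinomialRow_of_two_mul_lt (by push_cast; omega), rowWindow]
      push_cast
      rw [hs, show (2 : ℤ) ^ n + i + j - 2 ^ n = i + j by ring,
        show trinomialRow k (2 ^ n + i + j - 2 * 2 ^ n) = 0 from intCoeff_of_neg _ (by omega)]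
      simp

lemma truncSeq_eq_truncSeq_iff {m : ℕ} {s t : ℕ → ZMod 2} :
    truncSeq m s = truncSeq m t ↔ ∀ j < m, s j = t j := by
  constructor
  · intro h j hj
    simpa [truncSeq, hj] using congrFun h j
  · intro h
    funext j
    unfold truncSeq
    split_ifs with hj
    exacts [h j hj, rfl]

lemma truncSeq_apply {m j : ℕ} (hj : j < m) (s : ℕ → ZMod 2) : truncSeq m s j = s j := if_pos hj

lemma accessibleCount_eq (m : ℕ) :
    accessibleCount (1 + Polynomial.X + Polynomial.X ^ 2) 2 m = (blockSet m).ncard := by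
  have hinj : Set.InjOn (fun (s : ℕ → ZMod 2) (j : Fin m) => s j) (blockSet m) := by
    rintro _ ⟨k, i, rfl⟩ _ ⟨k', i', rfl⟩ h
    rw [truncSeq_eq_truncSeq_iff]
    intro j hj
    simpa [truncSeq, hj] using congrFun h ⟨j, hj⟩
  rw [accessibleCount, ← hinj.ncard_image]
  congr 1
  ext w
  simp only [Set.mem_ofPred_eq, isAccessibleBlock_iff, Set.mem_image, blockSet]
  constructor
  · rintro ⟨k, i, h⟩
    exact ⟨_, ⟨k, i, rfl⟩, funext fun j => by rw [truncSeq_apply j.2, h j]⟩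
  · rintro ⟨_, ⟨k, i, rfl⟩, rfl⟩
    exact ⟨k, i, fun j => truncSeq_apply j.2 _⟩

/-! ### The four ways in which a row determines the next rows -/

/-- `u 0, 0, u 1, 0, …`: a window of row `2 * k` from an even position. -/
def evenRowEvenStart (u : ℕ → ZMod 2) (j : ℕ) : ZMod 2 := if j % 2 = 0 then u (j / 2) else 0

/-- `0, u 0, 0, u 1, …`: a window of row `2 * k` from an odd position. -/
def evenRowOddStart (u : ℕ → ZMod 2) (j : ℕ) : ZMod 2 := if j % 2 = 0 then 0 else u (j / 2)

/-- `u 0, u 0 + u 1, u 1, u 1 + u 2, …`: a window of row `2 * k + 1` from an odd position. -/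
def oddRowOddStart (u : ℕ → ZMod 2) (j : ℕ) : ZMod 2 :=
  if j % 2 = 0 then u (j / 2) else u (j / 2) + u (j / 2 + 1)

/-- `u 0 + u 1, u 1, u 1 + u 2, u 2, …`: a window of row `2 * k + 1` from an even position. -/
def oddRowEvenStart (u : ℕ → ZMod 2) (j : ℕ) : ZMod 2 :=
  if j % 2 = 0 then u (j / 2) + u (j / 2 + 1) else u (j / 2 + 1)

lemma evenRowEvenStart_two_mul (u : ℕ → ZMod 2) (j : ℕ) : evenRowEvenStart u (2 * j) = u j := by
  simp [evenRowEvenStart]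

lemma evenRowEvenStart_two_mul_add_one (u : ℕ → ZMod 2) (j : ℕ) :
    evenRowEvenStart u (2 * j + 1) = 0 := by
  simp [evenRowEvenStart]

lemma evenRowOddStart_two_mul (u : ℕ → ZMod 2) (j : ℕ) : evenRowOddStart u (2 * j) = 0 := by
  simp [evenRowOddStart]

lemma evenRowOddStart_two_mul_add_one (u : ℕ → ZMod 2) (j : ℕ) :
    evenRowOddStart u (2 * j + 1) = u j := by
  simp [evenRowOddStart, show (2 * j + 1) / 2 = j by omega]

lemma oddRowOddStart_two_mul (u : ℕ → ZMod 2) (j : ℕ) : oddRowOddStart u (2 * j) = u j := by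
  simp [oddRowOddStart]

lemma oddRowOddStart_two_mul_add_one (u : ℕ → ZMod 2) (j : ℕ) :
    oddRowOddStart u (2 * j + 1) = u j + u (j + 1) := by
  simp [oddRowOddStart, show (2 * j + 1) / 2 = j by omega]

lemma oddRowEvenStart_two_mul (u : ℕ → ZMod 2) (j : ℕ) :
    oddRowEvenStart u (2 * j) = u j + u (j + 1) := by
  simp [oddRowEvenStart]

lemma oddRowEvenStart_two_mul_add_one (u : ℕ → ZMod 2) (j : ℕ) :
    oddRowEvenStart u (2 * j + 1) = u (j + 1) := by
  simp [oddRowEvenStart, show (2 * j + 1) / 2 = j by omega]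

lemma rowWindow_even_even (k : ℕ) (i : ℤ) :
    rowWindow (2 * k) (2 * i) = evenRowEvenStart (rowWindow k i) := by
  funext j
  obtain ⟨j, rfl | rfl⟩ := Nat.even_or_odd' j
  · rw [evenRowEvenStart_two_mul, rowWindow, rowWindow, ← trinomialRow_even_even k (i + j)]
    push_cast; ring_nf
  · rw [evenRowEvenStart_two_mul_add_one, rowWindow, ← trinomialRow_even_odd k (i + j)]
    push_cast; ring_nf

lemma rowWindow_even_odd (k : ℕ) (i : ℤ) :
    rowWindow (2 * k) (2 * i - 1) = evenRowOddStart (rowWindow k i) := by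
  funext j
  obtain ⟨j, rfl | rfl⟩ := Nat.even_or_odd' j
  · rw [evenRowOddStart_two_mul, rowWindow, ← trinomialRow_even_odd k (i + j - 1)]
    push_cast; ring_nf
  · rw [evenRowOddStart_two_mul_add_one, rowWindow, rowWindow, ← trinomialRow_even_even k (i + j)]
    push_cast; ring_nf

lemma rowWindow_odd_odd (k : ℕ) (i : ℤ) :
    rowWindow (2 * k + 1) (2 * i + 1) = oddRowOddStart (rowWindow k i) := by
  funext j
  obtain ⟨j, rfl | rfl⟩ := Nat.even_or_odd' j
  · rw [oddRowOddStart_two_mul, rowWindow, rowWindow, ← trinomialRow_odd_odd k (i + j)]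
    push_cast; ring_nf
  · have h := trinomialRow_odd_even k (i + j + 1)
    rw [add_sub_cancel_right, add_comm (trinomialRow k _)] at h
    rw [oddRowOddStart_two_mul_add_one, rowWindow, rowWindow, rowWindow, Nat.cast_add j 1,
      Nat.cast_one, ← add_assoc, ← h]
    push_cast; ring_nf

lemma rowWindow_odd_even (k : ℕ) (i : ℤ) :
    rowWindow (2 * k + 1) (2 * i + 2) = oddRowEvenStart (rowWindow k i) := by
  funext j
  obtain ⟨j, rfl | rfl⟩ := Nat.even_or_odd' j
  · have h := trinomialRow_odd_even k (i + j + 1)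
    rw [add_sub_cancel_right, add_comm (trinomialRow k _)] at h
    rw [oddRowEvenStart_two_mul, rowWindow, rowWindow, rowWindow, Nat.cast_add j 1,
      Nat.cast_one, ← add_assoc, ← h]
    push_cast; ring_nf
  · rw [oddRowEvenStart_two_mul_add_one, rowWindow, rowWindow,
      ← trinomialRow_odd_odd k (i + ↑(j + 1))]
    push_cast; ring_nf

/-- Blocks of length `m` obtained by applying `enc` to blocks of length `p`. -/
def encodedBlocks (enc : (ℕ → ZMod 2) → ℕ → ZMod 2) (m p : ℕ) : Set (ℕ → ZMod 2) :=
  (fun u => truncSeq m (enc u)) '' blockSet p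

/-- If the first `m` entries of `enc u` depend only on the first `p` entries of `u`, windows may
be used in place of blocks. -/
lemma mem_encodedBlocks_iff {enc : (ℕ → ZMod 2) → ℕ → ZMod 2} {m p : ℕ}
    (h : ∀ u v, (∀ j < p, u j = v j) → ∀ j < m, enc u j = enc v j) (w : ℕ → ZMod 2) :
    w ∈ encodedBlocks enc m p ↔ ∃ k i, w = truncSeq m (enc (rowWindow k i)) := by
  have key (k i) : truncSeq m (enc (truncSeq p (rowWindow k i))) =
      truncSeq m (enc (rowWindow k i)) :=
    truncSeq_eq_truncSeq_iff.mpr (h _ _ fun j hj => truncSeq_apply hj _)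
  constructor
  · rintro ⟨_, ⟨k, i, rfl⟩, rfl⟩
    exact ⟨k, i, key k i⟩
  · rintro ⟨k, i, rfl⟩
    exact ⟨_, ⟨k, i, rfl⟩, key k i⟩

lemma evenRowEvenStart_congr (m : ℕ) (u v : ℕ → ZMod 2) (h : ∀ j < (m + 1) / 2, u j = v j) :
    ∀ j < m, evenRowEvenStart u j = evenRowEvenStart v j := by
  intro j hj
  unfold evenRowEvenStart
  split_ifs
  exacts [h _ (by omega), rfl]

lemma evenRowOddStart_congr (m : ℕ) (u v : ℕ → ZMod 2) (h : ∀ j < m / 2, u j = v j) :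
    ∀ j < m, evenRowOddStart u j = evenRowOddStart v j := by
  intro j hj
  unfold evenRowOddStart
  split_ifs
  exacts [rfl, h _ (by omega)]

lemma oddRowOddStart_congr (m : ℕ) (u v : ℕ → ZMod 2) (h : ∀ j < m / 2 + 1, u j = v j) :
    ∀ j < m, oddRowOddStart u j = oddRowOddStart v j := by
  intro j hj
  unfold oddRowOddStart
  split_ifs
  · exact h _ (by omega)
  · rw [h _ (by omega), h _ (by omega)]

lemma oddRowEvenStart_congr (m : ℕ) (u v : ℕ → ZMod 2) (h : ∀ j < (m + 1) / 2 + 1, u j = v j) :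
    ∀ j < m, oddRowEvenStart u j = oddRowEvenStart v j := by
  intro j hj
  unfold oddRowEvenStart
  split_ifs
  · rw [h _ (by omega), h _ (by omega)]
  · exact h _ (by omega)

/-- The blocks of length `m` that occur in rows of even index. -/
def evenRowBlocks (m : ℕ) : Set (ℕ → ZMod 2) :=
  encodedBlocks evenRowEvenStart m ((m + 1) / 2) ∪ encodedBlocks evenRowOddStart m (m / 2)

/-- The blocks of length `m` that occur in rows of odd index. -/
def oddRowBlocks (m : ℕ) : Set (ℕ → ZMod 2) :=
  encodedBlocks oddRowOddStart m (m / 2 + 1) ∪ encodedBlocks oddRowEvenStart m ((m + 1) / 2 + 1)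

lemma blockSet_eq_union (m : ℕ) : blockSet m = evenRowBlocks m ∪ oddRowBlocks m := by
  ext w
  rw [evenRowBlocks, oddRowBlocks, Set.mem_union, Set.mem_union, Set.mem_union,
    mem_encodedBlocks_iff (evenRowEvenStart_congr m),
    mem_encodedBlocks_iff (evenRowOddStart_congr m), mem_encodedBlocks_iff (oddRowOddStart_congr m),
    mem_encodedBlocks_iff (oddRowEvenStart_congr m)]
  simp only [← rowWindow_even_even, ← rowWindow_even_odd, ← rowWindow_odd_odd,
    ← rowWindow_odd_even]
  constructor
  · rintro ⟨k, i, rfl⟩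
    obtain ⟨k, rfl | rfl⟩ := Nat.even_or_odd' k <;> obtain ⟨i, rfl | rfl⟩ := Int.even_or_odd' i
    · exact .inl (.inl ⟨k, i, rfl⟩)
    · exact .inl (.inr ⟨k, i + 1, by ring_nf⟩)
    · exact .inr (.inr ⟨k, i - 1, by ring_nf⟩)
    · exact .inr (.inl ⟨k, i, rfl⟩)
  · rintro ((⟨k, i, rfl⟩ | ⟨k, i, rfl⟩) | (⟨k, i, rfl⟩ | ⟨k, i, rfl⟩)) <;> exact ⟨_, _, rfl⟩

lemma truncSeq_self {m : ℕ} {w : ℕ → ZMod 2} (hw : w ∈ blockSet m) : truncSeq m w = w := by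
  obtain ⟨k, i, rfl⟩ := hw
  exact truncSeq_eq_truncSeq_iff.mpr fun j hj => truncSeq_apply hj _

lemma eq_of_mem_blockSet {m : ℕ} {u v : ℕ → ZMod 2} (hu : u ∈ blockSet m) (hv : v ∈ blockSet m)
    (h : ∀ j < m, u j = v j) : u = v := by
  rw [← truncSeq_self hu, ← truncSeq_self hv, truncSeq_eq_truncSeq_iff.mpr h]

lemma finite_blockSet (m : ℕ) : (blockSet m).Finite := by
  refine Set.Finite.of_finite_image (f := fun (s : ℕ → ZMod 2) (j : Fin m) => s j)
    (Set.toFinite _) fun u hu v hv h => eq_of_mem_blockSet hu hv fun j hj => ?_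
  exact congrFun h ⟨j, hj⟩

lemma ncard_encodedBlocks {enc : (ℕ → ZMod 2) → ℕ → ZMod 2} {m p : ℕ}
    (h : ∀ u v, (∀ j < m, enc u j = enc v j) → ∀ j < p, u j = v j) :
    (encodedBlocks enc m p).ncard = (blockSet p).ncard :=
  Set.InjOn.ncard_image fun u hu v hv huv =>
    eq_of_mem_blockSet hu hv (h u v (truncSeq_eq_truncSeq_iff.mp huv))

lemma ncard_evenRowEvenStart (m : ℕ) :
    (encodedBlocks evenRowEvenStart m ((m + 1) / 2)).ncard = (blockSet ((m + 1) / 2)).ncard := by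
  refine ncard_encodedBlocks fun u v h j hj => ?_
  simpa [evenRowEvenStart_two_mul] using h (2 * j) (by omega)

lemma ncard_evenRowOddStart (m : ℕ) :
    (encodedBlocks evenRowOddStart m (m / 2)).ncard = (blockSet (m / 2)).ncard := by
  refine ncard_encodedBlocks fun u v h j hj => ?_
  simpa [evenRowOddStart_two_mul_add_one] using h (2 * j + 1) (by omega)

lemma ncard_oddRowOddStart {m : ℕ} (hm : 2 ≤ m) :
    (encodedBlocks oddRowOddStart m (m / 2 + 1)).ncard = (blockSet (m / 2 + 1)).ncard := by
  refine ncard_encodedBlocks fun u v h j hj => ?_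
  rcases j with _ | j
  · simpa [oddRowOddStart] using h 0 (by omega)
  · have h₁ := h (2 * j) (by omega)
    have h₂ := h (2 * j + 1) (by omega)
    rw [oddRowOddStart_two_mul, oddRowOddStart_two_mul] at h₁
    rw [oddRowOddStart_two_mul_add_one, oddRowOddStart_two_mul_add_one, h₁] at h₂
    exact add_left_cancel h₂

lemma ncard_oddRowEvenStart {m : ℕ} (hm : 2 ≤ m) :
    (encodedBlocks oddRowEvenStart m ((m + 1) / 2 + 1)).ncard =
      (blockSet ((m + 1) / 2 + 1)).ncard := by
  refine ncard_encodedBlocks fun u v h j hj => ?_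
  have hodd (j : ℕ) (hj : 2 * j + 1 < m) : u (j + 1) = v (j + 1) := by
    simpa [oddRowEvenStart_two_mul_add_one] using h (2 * j + 1) hj
  have heven (j : ℕ) (hj : 2 * j < m) : u j + u (j + 1) = v j + v (j + 1) := by
    simpa [oddRowEvenStart_two_mul] using h (2 * j) hj
  rcases j with _ | j
  · have h₁ := heven 0 (by omega)
    rw [hodd 0 (by omega)] at h₁
    exact add_right_cancel h₁
  · by_cases hj' : 2 * j + 1 < m
    · exact hodd j hj'
    · obtain ⟨j, rfl⟩ : ∃ l, j = l + 1 := ⟨j - 1, by omega⟩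
      have h₁ := heven (j + 1) (by omega)
      rw [hodd j (by omega)] at h₁
      exact add_left_cancel h₁

/-! ### Blocks that arise in more than one way -/

lemma zmod_two_cases (a : ZMod 2) : a = 0 ∨ a = 1 := by
  revert a; decide

lemma zmod_two_eq_one {a : ZMod 2} (h : a ≠ 0) : a = 1 := (zmod_two_cases a).resolve_left h

lemma zero_mem_blockSet (m : ℕ) : 0 ∈ blockSet m := by
  refine ⟨0, 1, funext fun j => ?_⟩
  rw [truncSeq, rowWindow, trinomialRow_zero, if_neg (show ¬ ((1 : ℤ) + j = 0) by omega), ite_self]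
  rfl

lemma single_mem_blockSet {n m : ℕ} (h : n < m) : Pi.single n 1 ∈ blockSet m := by
  refine ⟨0, -n, funext fun j => ?_⟩
  rw [truncSeq, rowWindow, trinomialRow_zero, Pi.single_apply]
  split_ifs <;> first | rfl | omega

/-- A block shortened to its first entries is again a block. -/
lemma truncSeq_mem_blockSet {m p : ℕ} (h : p ≤ m) {w : ℕ → ZMod 2} (hw : w ∈ blockSet m) :
    truncSeq p w ∈ blockSet p := by
  obtain ⟨k, i, rfl⟩ := hw
  exact ⟨k, i, truncSeq_eq_truncSeq_iff.mpr fun j hj => truncSeq_apply (by omega) _⟩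

lemma exists_of_mem_encodedBlocks {enc : (ℕ → ZMod 2) → ℕ → ZMod 2} {m p : ℕ} {w : ℕ → ZMod 2}
    (hw : w ∈ encodedBlocks enc m p) : ∃ u ∈ blockSet p, ∀ j < m, w j = enc u j := by
  obtain ⟨u, hu, rfl⟩ := hw
  exact ⟨u, hu, fun j hj => truncSeq_apply hj _⟩

lemma mem_encodedBlocks {enc : (ℕ → ZMod 2) → ℕ → ZMod 2} {m p : ℕ} {u w : ℕ → ZMod 2}
    (hu : u ∈ blockSet p) (h : ∀ j < m, w j = enc u j) (h' : ∀ j, m ≤ j → w j = 0) :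
    w ∈ encodedBlocks enc m p := by
  refine ⟨u, hu, funext fun j => ?_⟩
  simp only [truncSeq]
  split_ifs with hj
  exacts [(h j hj).symm, (h' j (not_lt.mp hj)).symm]

lemma evenRowBlocks_subset (m : ℕ) : evenRowBlocks m ⊆ blockSet m :=
  blockSet_eq_union m ▸ Set.subset_union_left

lemma oddRowBlocks_subset (m : ℕ) : oddRowBlocks m ⊆ blockSet m :=
  blockSet_eq_union m ▸ Set.subset_union_right

/-- A block of even rows that starts both at an even and at an odd position is zero. -/
lemma evenRow_inter (m : ℕ) :
    encodedBlocks evenRowEvenStart m ((m + 1) / 2) ∩ encodedBlocks evenRowOddStart m (m / 2) =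
      {0} := by
  ext w
  simp only [Set.mem_inter_iff, Set.mem_singleton_iff]
  constructor
  · rintro ⟨h₁, h₂⟩
    have hw := evenRowBlocks_subset m (Or.inl h₁)
    obtain ⟨u, -, hu⟩ := exists_of_mem_encodedBlocks h₁
    obtain ⟨v, -, hv⟩ := exists_of_mem_encodedBlocks h₂
    refine eq_of_mem_blockSet hw (zero_mem_blockSet m) fun j hj => ?_
    obtain ⟨j, rfl | rfl⟩ := Nat.even_or_odd' j
    · rw [hv _ hj, evenRowOddStart_two_mul]; rfl
    · rw [hu _ hj, evenRowEvenStart_two_mul_add_one]; rfl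
  · rintro rfl
    exact ⟨mem_encodedBlocks (zero_mem_blockSet _) (by simp [evenRowEvenStart]) (by simp),
      mem_encodedBlocks (zero_mem_blockSet _) (by simp [evenRowOddStart]) (by simp)⟩

/-- The sequence `a, b, a + b, a, b, a + b, …`: the solution of the Fibonacci recursion modulo `2`
with first terms `a` and `b`. -/
def fibSeq (a b : ZMod 2) (j : ℕ) : ZMod 2 :=
  if j % 3 = 0 then a else if j % 3 = 1 then b else a + b

lemma fibSeq_add_two (a b : ZMod 2) (j : ℕ) :
    fibSeq a b (j + 2) = fibSeq a b j + fibSeq a b (j + 1) := by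
  have h : j % 3 = 0 ∨ j % 3 = 1 ∨ j % 3 = 2 := by omega
  have hab : b + (a + b) = a ∧ a + b + a = b := by revert a b; decide
  rcases h with h | h | h <;> simp [fibSeq, Nat.add_mod, h, hab]

lemma eq_fibSeq {m : ℕ} {w : ℕ → ZMod 2} (h : ∀ j, j + 2 < m → w (j + 2) = w j + w (j + 1)) :
    ∀ j < m, w j = fibSeq (w 0) (w 1) j := by
  intro j
  induction j using Nat.strong_induction_on with
  | _ j ih =>
    intro hj
    match j with
    | 0 => rfl
    | 1 => rfl
    | j + 2 =>
      rw [h j hj, fibSeq_add_two, ih j (by omega) (by omega),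
        ih (j + 1) (by omega) (by omega)]

/-- Sequences of this kind are reproduced by the passage to an odd row, so that all their initial
parts are accessible. -/
lemma oddRowOddStart_fibSeq (a b : ZMod 2) :
    oddRowOddStart (fibSeq a (a + b)) = fibSeq a b := by
  funext j
  refine (eq_fibSeq (m := j + 1) (fun i _ => ?_) j (by omega)).trans ?_
  · obtain ⟨i, rfl | rfl⟩ := Nat.even_or_odd' i
    · rw [show 2 * i + 2 = 2 * (i + 1) by ring, oddRowOddStart_two_mul,
        oddRowOddStart_two_mul_add_one, oddRowOddStart_two_mul, ← add_assoc,
        CharTwo.add_self_eq_zero, zero_add]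
    · rw [show 2 * i + 1 + 2 = 2 * (i + 1) + 1 by ring, show 2 * i + 1 + 1 = 2 * (i + 1) by ring,
        oddRowOddStart_two_mul_add_one, oddRowOddStart_two_mul_add_one, oddRowOddStart_two_mul,
        fibSeq_add_two]
      ring
  · congr 1
    rw [show (1 : ℕ) = 2 * 0 + 1 from rfl, oddRowOddStart_two_mul_add_one]
    simp [fibSeq, ← add_assoc, CharTwo.add_self_eq_zero]

lemma oddRowEvenStart_fibSeq (a b : ZMod 2) :
    oddRowEvenStart (fibSeq (a + b) b) = fibSeq a b := by
  funext j
  refine (eq_fibSeq (m := j + 1) (fun i _ => ?_) j (by omega)).trans ?_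
  · obtain ⟨i, rfl | rfl⟩ := Nat.even_or_odd' i
    · rw [show 2 * i + 2 = 2 * (i + 1) by ring, oddRowEvenStart_two_mul,
        oddRowEvenStart_two_mul_add_one, oddRowEvenStart_two_mul, fibSeq_add_two, add_comm,
        add_assoc]
    · rw [show 2 * i + 1 + 2 = 2 * (i + 1) + 1 by ring, show 2 * i + 1 + 1 = 2 * (i + 1) by ring,
        oddRowEvenStart_two_mul_add_one, oddRowEvenStart_two_mul_add_one, oddRowEvenStart_two_mul,
        ← add_assoc, CharTwo.add_self_eq_zero, zero_add]
  · have h₁ : oddRowEvenStart (fibSeq (a + b) b) 1 = b := rfl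
    have h₀ : oddRowEvenStart (fibSeq (a + b) b) 0 = a + b + b := rfl
    rw [h₁, h₀, add_assoc, CharTwo.add_self_eq_zero, add_zero]

/-- Every string of three digits occurs in one of the rows `1`, `111`, `10101`. -/
lemma truncSeq_three_mem_blockSet (w : ℕ → ZMod 2) : truncSeq 3 w ∈ blockSet 3 := by
  have key (k : ℕ) (i : ℤ) (h0 : w 0 = trinomialRow k i) (h1 : w 1 = trinomialRow k (i + 1))
      (h2 : w 2 = trinomialRow k (i + 2)) : truncSeq 3 w ∈ blockSet 3 := by
    refine ⟨k, i, truncSeq_eq_truncSeq_iff.mpr fun j hj => ?_⟩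
    interval_cases j <;> simp [rowWindow, h0, h1, h2]
  have row_one (t : ℤ) : trinomialRow 1 t = (if t = 0 then 1 else 0) +
      (if t - 1 = 0 then 1 else 0) + if t - 2 = 0 then 1 else 0 := by
    simpa only [mul_zero, zero_add, trinomialRow_zero] using trinomialRow_odd 0 t
  rcases zmod_two_cases (w 0) with h0 | h0 <;> rcases zmod_two_cases (w 1) with h1 | h1 <;>
    rcases zmod_two_cases (w 2) with h2 | h2 <;> simp only [h0, h1, h2] at key
  · exact key 0 1 (by simp [trinomialRow_zero]) (by simp [trinomialRow_zero])
      (by simp [trinomialRow_zero])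
  · exact key 0 (-2) (by simp [trinomialRow_zero]) (by simp [trinomialRow_zero])
      (by simp [trinomialRow_zero])
  · exact key 0 (-1) (by simp [trinomialRow_zero]) (by simp [trinomialRow_zero])
      (by simp [trinomialRow_zero])
  · exact key 1 (-1) (by simp [row_one]) (by simp [row_one]) (by simp [row_one])
  · exact key 0 0 (by simp [trinomialRow_zero]) (by simp [trinomialRow_zero])
      (by simp [trinomialRow_zero])
  · refine key 2 0 ?_ (trinomialRow_even_odd 1 0).symm ?_
    · exact ((trinomialRow_even_even 1 0).trans (by simp [row_one])).symm
    · exact ((trinomialRow_even_even 1 1).trans (by simp [row_one])).symm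
  · exact key 1 1 (by simp [row_one]) (by simp [row_one]) (by simp [row_one])
  · exact key 1 0 (by simp [row_one]) (by simp [row_one]) (by simp [row_one])

lemma truncSeq_fibSeq_mem_blockSet (a b : ZMod 2) (m : ℕ) :
    truncSeq m (fibSeq a b) ∈ blockSet m := by
  induction m using Nat.strong_induction_on generalizing a b with
  | _ m ih =>
    rcases le_or_gt m 3 with hm | hm
    · have h := truncSeq_mem_blockSet hm (truncSeq_three_mem_blockSet (fibSeq a b))
      rwa [truncSeq_eq_truncSeq_iff.mpr fun j hj => truncSeq_apply (by omega) _] at h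
    · refine oddRowBlocks_subset m (Or.inl ?_)
      refine mem_encodedBlocks (ih (m / 2 + 1) (by omega) a (a + b)) (fun j hj => ?_)
        fun j hj => if_neg (by omega)
      rw [truncSeq_apply hj, ← oddRowOddStart_fibSeq]
      exact oddRowOddStart_congr m _ _ (fun j hj => (truncSeq_apply hj _).symm) j hj

/-- In an odd row every entry at an even position is the sum of its two neighbours. A block that
starts at both kinds of positions has this property at all inner places, so it satisfies the
Fibonacci recursion modulo `2`. -/
lemma oddRow_inter (m : ℕ) :
    encodedBlocks oddRowOddStart m (m / 2 + 1) ∩ encodedBlocks oddRowEvenStart m ((m + 1) / 2 + 1) =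
      Set.range fun ab : ZMod 2 × ZMod 2 => truncSeq m (fibSeq ab.1 ab.2) := by
  ext w
  simp only [Set.mem_inter_iff, Set.mem_range, Prod.exists]
  constructor
  · rintro ⟨h₁, h₂⟩
    have hw := oddRowBlocks_subset m (Or.inl h₁)
    obtain ⟨u, -, hu⟩ := exists_of_mem_encodedBlocks h₁
    obtain ⟨v, -, hv⟩ := exists_of_mem_encodedBlocks h₂
    refine ⟨w 0, w 1, ?_⟩
    conv_rhs => rw [← truncSeq_self hw]
    refine (truncSeq_eq_truncSeq_iff.mpr (eq_fibSeq fun j hj => ?_)).symm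
    obtain ⟨j, rfl | rfl⟩ := Nat.even_or_odd' j
    · rw [hu _ hj, hu _ (by omega), hu _ (by omega), show 2 * j + 2 = 2 * (j + 1) by ring,
        oddRowOddStart_two_mul, oddRowOddStart_two_mul_add_one, oddRowOddStart_two_mul, ← add_assoc,
        CharTwo.add_self_eq_zero, zero_add]
    · rw [hv _ hj, hv _ (by omega), hv _ (by omega),
        show 2 * j + 1 + 2 = 2 * (j + 1) + 1 by ring, show 2 * j + 1 + 1 = 2 * (j + 1) by ring,
        oddRowEvenStart_two_mul_add_one, oddRowEvenStart_two_mul_add_one, oddRowEvenStart_two_mul,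
        ← add_assoc, CharTwo.add_self_eq_zero, zero_add]
  · rintro ⟨a, b, rfl⟩
    constructor
    · refine mem_encodedBlocks (truncSeq_fibSeq_mem_blockSet a (a + b) _) (fun j hj => ?_)
        fun j hj => if_neg (by omega)
      rw [truncSeq_apply hj, ← oddRowOddStart_fibSeq]
      exact oddRowOddStart_congr m _ _ (fun j hj => (truncSeq_apply hj _).symm) j hj
    · refine mem_encodedBlocks (truncSeq_fibSeq_mem_blockSet (a + b) b _) (fun j hj => ?_)
        fun j hj => if_neg (by omega)
      rw [truncSeq_apply hj, ← oddRowEvenStart_fibSeq]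
      exact oddRowEvenStart_congr m _ _ (fun j hj => (truncSeq_apply hj _).symm) j hj

lemma ncard_oddRow_inter {m : ℕ} (hm : 2 ≤ m) :
    (encodedBlocks oddRowOddStart m (m / 2 + 1) ∩
      encodedBlocks oddRowEvenStart m ((m + 1) / 2 + 1)).ncard = 4 := by
  rw [oddRow_inter, ← Set.image_univ, Set.InjOn.ncard_image, Set.ncard_univ, Nat.card_prod]
  · simp
  · rintro ⟨a, b⟩ - ⟨c, d⟩ - h
    have h' := truncSeq_eq_truncSeq_iff.mp h
    exact Prod.ext (h' 0 (by omega)) (h' 1 (by omega))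

lemma not_four_ones (k : ℕ) (t : ℤ) : ¬ (trinomialRow k t = 1 ∧ trinomialRow k (t + 1) = 1 ∧
    trinomialRow k (t + 2) = 1 ∧ trinomialRow k (t + 3) = 1) := by
  rintro ⟨h₀, h₁, h₂, h₃⟩
  obtain ⟨k, rfl | rfl⟩ := Nat.even_or_odd' k <;> obtain ⟨t, rfl | rfl⟩ := Int.even_or_odd' t
  · simp [trinomialRow_even_odd] at h₁
  · simp [trinomialRow_even_odd] at h₀
  · rw [show 2 * t + 2 = 2 * (t + 1) by ring, trinomialRow_odd_even, add_sub_cancel_right] at h₂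
    rw [show 2 * t + 3 = 2 * (t + 1) + 1 by ring, trinomialRow_odd_odd] at h₃
    rw [trinomialRow_odd_odd] at h₁
    rw [h₁, h₃] at h₂
    exact absurd h₂ (by decide)
  · rw [show 2 * t + 1 + 1 = 2 * (t + 1) by ring, trinomialRow_odd_even, add_sub_cancel_right] at h₁
    rw [show 2 * t + 1 + 2 = 2 * (t + 1) + 1 by ring, trinomialRow_odd_odd] at h₂
    rw [trinomialRow_odd_odd] at h₀
    rw [h₀, h₂] at h₁
    exact absurd h₁ (by decide)

/-- A constant block of length at least four is zero. -/
lemma eq_zero_of_constant {p : ℕ} (hp : 4 ≤ p) {u : ℕ → ZMod 2} (hu : u ∈ blockSet p)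
    (h : ∀ j, j + 1 < p → u j + u (j + 1) = 0) : ∀ j < p, u j = 0 := by
  have hc : ∀ j < p, u j = u 0 := by
    intro j
    induction j with
    | zero => intro _; rfl
    | succ j ih => intro hj; rw [← ih (by omega)]; exact (CharTwo.add_eq_zero.mp (h j hj)).symm
  by_contra! hne
  obtain ⟨j, hj, hne⟩ := hne
  have h0 : u 0 = 1 := zmod_two_eq_one (hc j hj ▸ hne)
  obtain ⟨k, i, rfl⟩ := hu
  refine not_four_ones k i ⟨?_, ?_, ?_, ?_⟩
  · simpa [truncSeq, rowWindow, show 0 < p by omega] using h0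
  · simpa [truncSeq, rowWindow, show 1 < p by omega, h0] using (hc 1 (by omega)).trans h0
  · simpa [truncSeq, rowWindow, show 2 < p by omega, h0] using (hc 2 (by omega)).trans h0
  · simpa [truncSeq, rowWindow, show 3 < p by omega, h0] using (hc 3 (by omega)).trans h0

/-- Two ones are never separated by a run of zeros of even positive length. -/
lemma not_one_zeros_one {L p : ℕ} (hL : L ≠ 0) (hL2 : Even L) (hp : L + 1 < p) {u : ℕ → ZMod 2}
    (hu : u ∈ blockSet p) (h : ∀ j, j ≠ 0 → j ≤ L → u j = 0) : ¬ (u 0 = 1 ∧ u (L + 1) = 1) := by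
  rintro ⟨h0, h1⟩
  obtain ⟨l, rfl⟩ : ∃ l, L = 2 * l + 2 := by
    obtain ⟨r, hr⟩ := hL2; exact ⟨r - 1, by omega⟩
  have hu' := truncSeq_mem_blockSet (p := 2 * l + 4) (by omega) hu
  have hu'' (j : ℕ) (hj : j < 2 * l + 4) : truncSeq (2 * l + 4) u j = u j := truncSeq_apply hj _
  rw [blockSet_eq_union] at hu'
  rcases hu' with (hv | hv) | (hv | hv) <;> obtain ⟨v, -, hv⟩ := exists_of_mem_encodedBlocks hv
  · rw [← hu'' _ (by omega), hv _ (by omega), show 2 * l + 2 + 1 = 2 * (l + 1) + 1 by ring,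
      evenRowEvenStart_two_mul_add_one] at h1
    exact absurd h1 (by decide)
  · rw [← hu'' _ (by omega), hv _ (by omega)] at h0
    exact absurd h0 (by simp [evenRowOddStart])
  · have h2 := h 1 (by omega) (by omega)
    have h3 := h 2 (by omega) (by omega)
    rw [← hu'' _ (by omega), hv _ (by omega)] at h0 h2 h3
    simp only [oddRowOddStart] at h0 h2 h3
    norm_num at h0 h2 h3
    rw [h0, h3] at h2
    exact absurd h2 (by decide)
  · have h2 := h (2 * l + 1) (by omega) (by omega)
    have h3 := h (2 * (l + 1)) (by omega) (by omega)
    rw [← hu'' _ (by omega), hv _ (by omega)] at h1 h2 h3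
    rw [oddRowEvenStart_two_mul_add_one] at h2
    rw [oddRowEvenStart_two_mul, h2] at h3
    rw [show 2 * l + 2 + 1 = 2 * (l + 1) + 1 by ring, oddRowEvenStart_two_mul_add_one] at h1
    rw [h1] at h3
    exact absurd h3 (by decide)

lemma eq_zero_or_single {m : ℕ} (hm : m ≠ 0) {w : ℕ → ZMod 2} (hw : w ∈ blockSet m)
    (h : ∀ j, j ≠ 0 → j + 1 < m → w j = 0) (h' : ¬ (w 0 = 1 ∧ w (m - 1) = 1)) :
    w = 0 ∨ w = Pi.single 0 1 ∨ w = Pi.single (m - 1) 1 := by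
  have key (v : ℕ → ZMod 2) (hv : v ∈ blockSet m) (h0 : w 0 = v 0) (h1 : w (m - 1) = v (m - 1))
      (h2 : ∀ j, j ≠ 0 → j + 1 < m → v j = 0) : w = v := by
    refine eq_of_mem_blockSet hw hv fun j hj => ?_
    rcases eq_or_ne j 0 with rfl | hj0
    · exact h0
    · rcases eq_or_ne j (m - 1) with rfl | hj1
      · exact h1
      · rw [h j hj0 (by omega), h2 j hj0 (by omega)]
  by_cases h0 : w 0 = 0 <;> by_cases h1 : w (m - 1) = 0
  · exact .inl (key 0 (zero_mem_blockSet m) h0 h1 fun _ _ _ => rfl)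
  · refine .inr (.inr (key _ (single_mem_blockSet (by omega)) ?_ ?_ ?_))
    · have : m - 1 ≠ 0 := by rintro h; rw [h] at h1; exact h1 h0
      rw [h0, Pi.single_eq_of_ne this.symm]
    · rw [zmod_two_eq_one h1, Pi.single_eq_same]
    · intro j _ hj; exact Pi.single_eq_of_ne (by omega) _
  · refine .inr (.inl (key _ (single_mem_blockSet (by omega)) ?_ ?_ ?_))
    · rw [zmod_two_eq_one h0, Pi.single_eq_same]
    · have : m - 1 ≠ 0 := by rintro h; rw [h] at h1; exact h0 h1
      rw [h1, Pi.single_eq_of_ne this]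
    · intro j hj _; exact Pi.single_eq_of_ne hj _
  · exact absurd ⟨zmod_two_eq_one h0, zmod_two_eq_one h1⟩ h'

lemma single_zero_mem_inter {m : ℕ} (hm : 2 ≤ m) :
    Pi.single 0 1 ∈ evenRowBlocks m ∩ oddRowBlocks m := by
  constructor
  · refine .inl (mem_encodedBlocks (single_mem_blockSet (n := 0) (by omega)) (fun j hj => ?_)
      fun j hj => Pi.single_eq_of_ne (by omega) _)
    simp only [evenRowEvenStart, Pi.single_apply]
    split_ifs <;> first | rfl | omega
  · refine .inr (mem_encodedBlocks (single_mem_blockSet (n := 0) (by omega)) (fun j hj => ?_)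
      fun j hj => Pi.single_eq_of_ne (by omega) _)
    simp only [oddRowEvenStart, Pi.single_apply]
    split_ifs <;> first | rfl | omega | contradiction

lemma single_last_mem_inter {m : ℕ} (hm : 2 ≤ m) :
    Pi.single (m - 1) 1 ∈ evenRowBlocks m ∩ oddRowBlocks m := by
  obtain ⟨n, rfl | rfl⟩ := Nat.even_or_odd' m
  · constructor
    · refine .inr (mem_encodedBlocks (single_mem_blockSet (n := n - 1) (by omega)) (fun j hj => ?_)
        fun j hj => Pi.single_eq_of_ne (by omega) _)
      simp only [evenRowOddStart, Pi.single_apply]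
      split_ifs <;> first | rfl | omega
    · refine .inl (mem_encodedBlocks (single_mem_blockSet (n := n) (by omega)) (fun j hj => ?_)
        fun j hj => Pi.single_eq_of_ne (by omega) _)
      simp only [oddRowOddStart, Pi.single_apply]
      split_ifs <;> first | rfl | omega
  · constructor
    · refine .inl (mem_encodedBlocks (single_mem_blockSet (n := n) (by omega)) (fun j hj => ?_)
        fun j hj => Pi.single_eq_of_ne (by omega) _)
      simp only [evenRowEvenStart, Pi.single_apply]
      split_ifs <;> first | rfl | omega
    · refine .inr (mem_encodedBlocks (single_mem_blockSet (n := n + 1) (by omega))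
        (fun j hj => ?_) fun j hj => Pi.single_eq_of_ne (by omega) _)
      simp only [oddRowEvenStart, Pi.single_apply]
      split_ifs <;> first | rfl | omega

lemma zero_mem_inter (m : ℕ) : 0 ∈ evenRowBlocks m ∩ oddRowBlocks m := by
  constructor
  · exact .inl (mem_encodedBlocks (zero_mem_blockSet _) (by simp [evenRowEvenStart]) (by simp))
  · exact .inl (mem_encodedBlocks (zero_mem_blockSet _) (by simp [oddRowOddStart]) (by simp))

/-- A block of an even row has zeros at every other place. If it also occurs in an odd row, this
forces the underlying block of that row to be constant, hence zero, or to vanish except possibly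
at its ends. -/
lemma evenRow_inter_oddRow {m : ℕ} (hm : 6 ≤ m) :
    evenRowBlocks m ∩ oddRowBlocks m = {0, Pi.single 0 1, Pi.single (m - 1) 1} := by
  apply Set.Subset.antisymm
  · rintro w ⟨he, ho⟩
    have hw := evenRowBlocks_subset m he
    suffices h : (∀ j, j ≠ 0 → j + 1 < m → w j = 0) ∧ ¬ (w 0 = 1 ∧ w (m - 1) = 1) from
      eq_zero_or_single (by omega) hw h.1 h.2
    rcases he with he | he <;> rcases ho with ho | ho <;>
      obtain ⟨v, hvm, hv⟩ := exists_of_mem_encodedBlocks he <;>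
      obtain ⟨u, hum, hu⟩ := exists_of_mem_encodedBlocks ho
    · have hu0 : ∀ j < m / 2 + 1, u j = 0 := eq_zero_of_constant (by omega) hum fun j hj => by
        rw [← oddRowOddStart_two_mul_add_one, ← hu _ (by omega), hv _ (by omega),
          evenRowEvenStart_two_mul_add_one]
      have hw0 : ∀ j < m, w j = 0 := fun j hj => by
        rw [hu j hj, oddRowOddStart_congr m u 0 hu0 j hj]; simp [oddRowOddStart]
      exact ⟨fun j _ hj => hw0 j (by omega), fun h => by simp [hw0 0 (by omega)] at h⟩
    · have hu0 (j : ℕ) (hj : 2 * j + 1 < m) : u (j + 1) = 0 := by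
        rw [← oddRowEvenStart_two_mul_add_one u, ← hu _ hj, hv _ hj,
          evenRowEvenStart_two_mul_add_one]
      have hw0 : ∀ j, j ≠ 0 → j + 1 < m → w j = 0 := fun j hj0 hj => by
        obtain ⟨j, rfl | rfl⟩ := Nat.even_or_odd' j
        · obtain ⟨j, rfl⟩ : ∃ i, j = i + 1 := ⟨j - 1, by omega⟩
          rw [hu _ (by omega), oddRowEvenStart_two_mul, hu0 j (by omega), hu0 (j + 1) (by omega),
            add_zero]
        · rw [hu _ (by omega), oddRowEvenStart_two_mul_add_one, hu0 j (by omega)]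
      refine ⟨hw0, fun ⟨h0, h1⟩ => ?_⟩
      obtain ⟨n, rfl | rfl⟩ := Nat.even_or_odd' m
      · rw [hv _ (by omega), show 2 * n - 1 = 2 * (n - 1) + 1 by omega,
          evenRowEvenStart_two_mul_add_one] at h1
        exact absurd h1 (by decide)
      · -- Both `v` and `u` are two ones separated by zeros, with `n - 1` and `n` zeros; one of
        -- these numbers is even.
        rw [add_tsub_cancel_right] at h1
        have hv1 (j : ℕ) (hj : j ≤ n) : v j = w (2 * j) := by
          rw [hv _ (by omega), evenRowEvenStart_two_mul]
        have hu1 : u 0 = 1 := by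
          rw [hu _ (by omega), show 0 = 2 * 0 from rfl, oddRowEvenStart_two_mul,
            hu0 0 (by omega), add_zero] at h0
          exact h0
        have hu2 : u (n + 1) = 1 := by
          obtain ⟨l, rfl⟩ : ∃ l, n = l + 1 := ⟨n - 1, by omega⟩
          rwa [hu _ (by omega), oddRowEvenStart_two_mul, hu0 l (by omega), zero_add] at h1
        rcases Nat.even_or_odd n with hn | hn
        · refine not_one_zeros_one (L := n) (by omega) hn (by omega) hum (fun j hj0 hj => ?_)
            ⟨hu1, hu2⟩
          obtain ⟨j, rfl⟩ : ∃ i, j = i + 1 := ⟨j - 1, by omega⟩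
          exact hu0 j (by omega)
        · refine not_one_zeros_one (L := n - 1) (by omega) (Nat.Odd.sub_odd hn odd_one) (by omega)
            hvm (fun j hj0 hj => ?_) ⟨?_, ?_⟩
          · rw [hv1 j (by omega), hw0 _ (by omega) (by omega)]
          · rw [hv1 0 (by omega), mul_zero, h0]
          · rw [show n - 1 + 1 = n by omega, hv1 n le_rfl, h1]
    · have hu0 (j : ℕ) (hj : 2 * j < m) : u j = 0 := by
        rw [← oddRowOddStart_two_mul u, ← hu _ hj, hv _ hj, evenRowOddStart_two_mul]
      refine ⟨fun j hj0 hj => ?_, fun h => ?_⟩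
      · obtain ⟨j, rfl | rfl⟩ := Nat.even_or_odd' j
        · rw [hu _ (by omega), oddRowOddStart_two_mul, hu0 j (by omega)]
        · rw [hu _ (by omega), oddRowOddStart_two_mul_add_one, hu0 j (by omega),
            hu0 (j + 1) (by omega), add_zero]
      · have h0 := h.1
        rw [hu _ (by omega), show 0 = 2 * 0 from rfl, oddRowOddStart_two_mul,
          hu0 0 (by omega)] at h0
        exact absurd h0 (by decide)
    · have hu0 : ∀ j < (m + 1) / 2 + 1, u j = 0 :=
        eq_zero_of_constant (by omega) hum fun j hj => by
          rw [← oddRowEvenStart_two_mul, ← hu _ (by omega), hv _ (by omega),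
            evenRowOddStart_two_mul]
      have hw0 : ∀ j < m, w j = 0 := fun j hj => by
        rw [hu j hj, oddRowEvenStart_congr m u 0 hu0 j hj]; simp [oddRowEvenStart]
      exact ⟨fun j _ hj => hw0 j (by omega), fun h => by simp [hw0 0 (by omega)] at h⟩
  · rintro w (rfl | rfl | rfl)
    exacts [zero_mem_inter m, single_zero_mem_inter (by omega), single_last_mem_inter (by omega)]

lemma ncard_evenRow_inter_oddRow {m : ℕ} (hm : 6 ≤ m) :
    (evenRowBlocks m ∩ oddRowBlocks m).ncard = 3 := by
  rw [evenRow_inter_oddRow hm]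
  have hne (n : ℕ) : (0 : ℕ → ZMod 2) ≠ Pi.single n 1 := fun h => by
    simpa using congrFun h n
  rw [Set.ncard_eq_three]
  refine ⟨_, _, _, hne 0, hne (m - 1), fun h => ?_, rfl⟩
  have := congrFun h 0
  rw [Pi.single_eq_same, Pi.single_eq_of_ne (by omega)] at this
  exact absurd this (by decide)

/-! ### The recursion for the number of blocks -/

/-- Inclusion–exclusion for the four kinds of blocks, the overlaps having `1`, `4` and `3`
elements. -/
lemma ncard_blockSet_add_eight {m : ℕ} (hm : 6 ≤ m) :
    (blockSet m).ncard + 8 = (blockSet ((m + 1) / 2)).ncard + (blockSet (m / 2)).ncard +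
      (blockSet (m / 2 + 1)).ncard + (blockSet ((m + 1) / 2 + 1)).ncard := by
  have hfin {enc : (ℕ → ZMod 2) → ℕ → ZMod 2} {p : ℕ} : (encodedBlocks enc m p).Finite :=
    (finite_blockSet p).image _
  have h₁ := Set.ncard_union_add_ncard_inter (evenRowBlocks m) (oddRowBlocks m)
    (hfin.union hfin) (hfin.union hfin)
  have h₂ := Set.ncard_union_add_ncard_inter (encodedBlocks evenRowEvenStart m ((m + 1) / 2))
    (encodedBlocks evenRowOddStart m (m / 2)) hfin hfin
  have h₃ := Set.ncard_union_add_ncard_inter (encodedBlocks oddRowOddStart m (m / 2 + 1))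
    (encodedBlocks oddRowEvenStart m ((m + 1) / 2 + 1)) hfin hfin
  rw [← blockSet_eq_union, ncard_evenRow_inter_oddRow hm] at h₁
  rw [evenRow_inter, Set.ncard_singleton, ncard_evenRowEvenStart, ncard_evenRowOddStart,
    ← evenRowBlocks] at h₂
  rw [ncard_oddRow_inter (by omega), ncard_oddRowOddStart (by omega),
    ncard_oddRowEvenStart (by omega), ← oddRowBlocks] at h₃
  omega

/-- Extension of a string of `m` digits by zeros. -/
def padSeq {m : ℕ} (w : Fin m → ZMod 2) (j : ℕ) : ZMod 2 := if h : j < m then w ⟨j, h⟩ else 0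

lemma padSeq_injective (m : ℕ) : Function.Injective (padSeq (m := m)) := fun u v h =>
  funext fun j => by simpa [padSeq] using congrFun h j

lemma blockSet_eq_image (m : ℕ) :
    blockSet m = padSeq '' {w : Fin m → ZMod 2 | padSeq w ∈ blockSet m} := by
  ext w
  constructor
  · intro hw
    have h : padSeq (fun j : Fin m => w j) = w := by
      conv_rhs => rw [← truncSeq_self hw]
      funext j
      simp [padSeq, truncSeq]
    exact ⟨_, show _ ∈ blockSet m by rwa [h], h⟩
  · rintro ⟨v, hv, rfl⟩
    exact hv

lemma ncard_blockSet_eq_card {m : ℕ} (P : (Fin m → ZMod 2) → Prop) [DecidablePred P]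
    (h : ∀ w, padSeq w ∈ blockSet m ↔ P w) :
    (blockSet m).ncard = (Finset.univ.filter P).card := by
  rw [blockSet_eq_image, Set.ncard_image_of_injective _ (padSeq_injective m),
    ← Set.ncard_coe_finset]
  congr 1
  ext w
  simp [h]

lemma padSeq_mem_blockSet {m : ℕ} (hm : m ≤ 3) (w : Fin m → ZMod 2) : padSeq w ∈ blockSet m := by
  have h := truncSeq_mem_blockSet hm (truncSeq_three_mem_blockSet (padSeq w))
  convert h using 1
  funext j
  simp only [padSeq, truncSeq]
  split_ifs <;> first | rfl | omega

lemma ncard_blockSet_of_le_three {m : ℕ} (hm : m ≤ 3) : (blockSet m).ncard = 2 ^ m := by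
  rw [ncard_blockSet_eq_card (fun _ => True) fun w => by simp [padSeq_mem_blockSet hm]]
  simp

/-! ### Blocks of length four and five -/

/-- The four digits are neither `1111` nor `1001`. -/
def IsAdmissible (a b c d : ZMod 2) : Prop := ¬ (a = 1 ∧ d = 1 ∧ b = c)

instance (a b c d : ZMod 2) : Decidable (IsAdmissible a b c d) :=
  inferInstanceAs (Decidable (¬ _))

lemma isAdmissible_of_mem_blockSet {m : ℕ} {w : ℕ → ZMod 2} (hw : w ∈ blockSet m) {t : ℕ}
    (ht : t + 3 < m) : IsAdmissible (w t) (w (t + 1)) (w (t + 2)) (w (t + 3)) := by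
  obtain ⟨k, i, rfl⟩ := hw
  rw [truncSeq_apply (by omega), truncSeq_apply (by omega), truncSeq_apply (by omega),
    truncSeq_apply ht]
  have hmem : truncSeq 4 (rowWindow k (i + t)) ∈ blockSet 4 := ⟨k, _, rfl⟩
  have hu (j : ℕ) (hj : j < 4) :
      rowWindow k i (t + j) = truncSeq 4 (rowWindow k (i + t)) j := by
    simp only [truncSeq_apply hj, rowWindow, Nat.cast_add, add_assoc]
  rw [hu 1 (by omega), hu 2 (by omega), hu 3 (by omega), ← add_zero t, hu 0 (by omega), add_zero]
  set u := rowWindow k (i + t)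
  rintro ⟨h0, h3, h12⟩
  rcases zmod_two_cases (truncSeq 4 u 1) with h1 | h1
  · refine not_one_zeros_one (L := 2) two_ne_zero even_two (by omega) hmem (fun j hj0 hj => ?_)
      ⟨h0, h3⟩
    obtain rfl | rfl : j = 1 ∨ j = 2 := by omega
    exacts [h1, h12.symm.trans h1]
  · have h2 : truncSeq 4 u 2 = 1 := h12.symm.trans h1
    have h3' : truncSeq 4 u 3 = 1 := h3
    have := eq_zero_of_constant le_rfl hmem (fun j hj => ?_) 0 (by omega)
    · rw [h0] at this
      exact absurd this (by decide)
    · obtain rfl | rfl | rfl : j = 0 ∨ j = 1 ∨ j = 2 := by omega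
      · rw [h0, h1]; rfl
      · rw [h1, h2]; rfl
      · rw [h2, h3']; rfl

/-- A string satisfying the condition has one of the four shapes that come from blocks of length at
most three, all of which are accessible. -/
lemma padSeq_four_mem_blockSet_iff (w : Fin 4 → ZMod 2) :
    padSeq w ∈ blockSet 4 ↔ IsAdmissible (w 0) (w 1) (w 2) (w 3) := by
  refine ⟨fun h => isAdmissible_of_mem_blockSet h (t := 0) (by omega), fun h => ?_⟩
  have hz (j : ℕ) (hj : 4 ≤ j) : padSeq w j = 0 := dif_neg (by omega)
  have cases : (w 1 = 0 ∧ w 3 = 0) ∨ (w 0 = 0 ∧ w 2 = 0) ∨ w 1 = w 0 + w 2 ∨ w 2 = w 1 + w 3 := by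
    revert h
    generalize w 0 = a, w 1 = b, w 2 = c, w 3 = d
    revert a b c d
    decide
  rw [blockSet_eq_union]
  rcases cases with ⟨h1, h3⟩ | ⟨h0, h2⟩ | h1 | h2
  · refine .inl (.inl (mem_encodedBlocks (padSeq_mem_blockSet (by norm_num) ![w 0, w 2])
      (fun j hj => ?_) hz))
    interval_cases j <;> simp [padSeq, evenRowEvenStart, h1, h3]
  · refine .inl (.inr (mem_encodedBlocks (padSeq_mem_blockSet (by norm_num) ![w 1, w 3])
      (fun j hj => ?_) hz))
    interval_cases j <;> simp [padSeq, evenRowOddStart, h0, h2]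
  · refine .inr (.inl (mem_encodedBlocks (padSeq_mem_blockSet (by norm_num) ![w 0, w 2, w 2 + w 3])
      (fun j hj => ?_) hz))
    interval_cases j <;> simp [padSeq, oddRowOddStart, h1, ← add_assoc, CharTwo.add_self_eq_zero]
  · refine .inr (.inr (mem_encodedBlocks (padSeq_mem_blockSet (by norm_num) ![w 0 + w 1, w 1, w 3])
      (fun j hj => ?_) hz))
    interval_cases j <;> simp [padSeq, oddRowEvenStart, h2, add_assoc, CharTwo.add_self_eq_zero]

/-- A string satisfying the condition has one of the four shapes that come from accessible blocks of
length at most four. -/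
lemma padSeq_five_mem_blockSet_iff (w : Fin 5 → ZMod 2) :
    padSeq w ∈ blockSet 5 ↔
      IsAdmissible (w 0) (w 1) (w 2) (w 3) ∧ IsAdmissible (w 1) (w 2) (w 3) (w 4) := by
  refine ⟨fun h => ⟨isAdmissible_of_mem_blockSet h (t := 0) (by omega),
    isAdmissible_of_mem_blockSet h (t := 1) (by omega)⟩, fun h => ?_⟩
  have hz (j : ℕ) (hj : 5 ≤ j) : padSeq w j = 0 := dif_neg (by omega)
  have cases : (w 1 = 0 ∧ w 3 = 0) ∨ (w 0 = 0 ∧ w 2 = 0 ∧ w 4 = 0) ∨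
      (w 1 = w 0 + w 2 ∧ w 3 = w 2 + w 4) ∨
      (w 2 = w 1 + w 3 ∧ IsAdmissible (w 0 + w 1) (w 1) (w 3) (w 3 + w 4)) := by
    revert h
    generalize w 0 = a, w 1 = b, w 2 = c, w 3 = d, w 4 = e
    revert a b c d e
    decide
  rw [blockSet_eq_union]
  rcases cases with ⟨h1, h3⟩ | ⟨h0, h2, h4⟩ | ⟨h1, h3⟩ | ⟨h2, h⟩
  · refine .inl (.inl (mem_encodedBlocks (padSeq_mem_blockSet (by norm_num) ![w 0, w 2, w 4])
      (fun j hj => ?_) hz))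
    interval_cases j <;> simp [padSeq, evenRowEvenStart, h1, h3]
  · refine .inl (.inr (mem_encodedBlocks (padSeq_mem_blockSet (by norm_num) ![w 1, w 3])
      (fun j hj => ?_) hz))
    interval_cases j <;> simp [padSeq, evenRowOddStart, h0, h2, h4]
  · refine .inr (.inl (mem_encodedBlocks (padSeq_mem_blockSet (by norm_num) ![w 0, w 2, w 4])
      (fun j hj => ?_) hz))
    interval_cases j <;> simp [padSeq, oddRowOddStart, h1, h3]
  · refine .inr (.inr (mem_encodedBlocks
      ((padSeq_four_mem_blockSet_iff ![w 0 + w 1, w 1, w 3, w 3 + w 4]).mpr h)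
      (fun j hj => ?_) hz))
    interval_cases j <;>
      simp [padSeq, oddRowEvenStart, h2, add_assoc, CharTwo.add_self_eq_zero]
    rw [← add_assoc, CharTwo.add_self_eq_zero, zero_add]

lemma ncard_blockSet_four : (blockSet 4).ncard = 14 := by
  rw [ncard_blockSet_eq_card _ padSeq_four_mem_blockSet_iff]
  decide

lemma ncard_blockSet_five : (blockSet 5).ncard = 25 := by
  rw [ncard_blockSet_eq_card _ padSeq_five_mem_blockSet_iff]
  decide

/-! ### The generating function -/

open Classical in
/-- The coefficient of `z ^ j` in `∑ i, (z ^ (2 ^ i) - z ^ (3 * 2 ^ i))`. -/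
noncomputable def lacunaryCoeff (j : ℕ) : ℚ :=
  (if ∃ i, j = 2 ^ i then 1 else 0) - if ∃ i, j = 3 * 2 ^ i then 1 else 0

open Classical in
lemma hasSum_coeff_X_pow {φ : ℕ → ℕ} (hφ : Function.Injective φ) (j : ℕ) :
    HasSum (fun i => PowerSeries.coeff j (PowerSeries.X ^ φ i : PowerSeries ℚ))
      (if ∃ i, j = φ i then 1 else 0) := by
  simp only [PowerSeries.coeff_X_pow]
  split_ifs with h
  · obtain ⟨i, rfl⟩ := h
    simpa only [hφ.eq_iff] using hasSum_ite_eq' i (1 : ℚ)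
  · push Not at h
    simpa only [if_neg (h _)] using hasSum_zero

/-- The series converges because each of its coefficients is a sum with at most one nonzero term
`z ^ (2 ^ i)` and at most one nonzero term `z ^ (3 * 2 ^ i)`. -/
lemma hasSum_lacunary :
    HasSum (fun i : ℕ => (PowerSeries.X ^ (2 ^ i) - PowerSeries.X ^ (3 * 2 ^ i) : PowerSeries ℚ))
      (PowerSeries.mk lacunaryCoeff) := by
  rw [PowerSeries.WithPiTopology.hasSum_iff_hasSum_coeff]
  intro j
  simp only [map_sub, PowerSeries.coeff_mk]
  exact (hasSum_coeff_X_pow (Nat.pow_right_injective le_rfl) j).sub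
    (hasSum_coeff_X_pow (φ := fun i => 3 * 2 ^ i)
      (fun a b h => Nat.pow_right_injective le_rfl (Nat.eq_of_mul_eq_mul_left three_pos h)) j)

lemma exists_eq_mul_two_pow_two_mul {c : ℕ} (hc : Odd c) (j : ℕ) :
    (∃ i, 2 * j = c * 2 ^ i) ↔ ∃ i, j = c * 2 ^ i := by
  constructor
  · rintro ⟨_ | i, hi⟩
    · obtain ⟨r, rfl⟩ := hc; omega
    · exact ⟨i, by rw [pow_succ] at hi; linarith⟩
  · rintro ⟨i, rfl⟩
    exact ⟨i + 1, by ring⟩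

lemma exists_eq_mul_two_pow_of_odd {c j : ℕ} (hj : Odd j) : (∃ i, j = c * 2 ^ i) ↔ j = c := by
  constructor
  · rintro ⟨_ | i, rfl⟩
    · simp
    · exact absurd hj (by simp [pow_succ])
  · rintro rfl
    exact ⟨0, by simp⟩

open Classical in
lemma lacunaryCoeff_two_mul (j : ℕ) : lacunaryCoeff (2 * j) = lacunaryCoeff j := by
  have h := exists_eq_mul_two_pow_two_mul odd_one j
  simp only [one_mul] at h
  exact congrArg₂ (· - ·) (if_congr h rfl rfl)
    (if_congr (exists_eq_mul_two_pow_two_mul (by decide) j) rfl rfl)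

open Classical in
lemma lacunaryCoeff_of_odd {j : ℕ} (hj : Odd j) :
    lacunaryCoeff j = (if j = 1 then 1 else 0) - if j = 3 then 1 else 0 := by
  have h := exists_eq_mul_two_pow_of_odd (c := 1) hj
  simp only [one_mul] at h
  exact congrArg₂ (· - ·) (if_congr h rfl rfl)
    (if_congr (exists_eq_mul_two_pow_of_odd hj) rfl rfl)

lemma lacunaryCoeff_zero : lacunaryCoeff 0 = 0 := by
  simp [lacunaryCoeff, eq_comm (a := 0)]

lemma lacunaryCoeff_values : lacunaryCoeff 1 = 1 ∧ lacunaryCoeff 2 = 1 ∧ lacunaryCoeff 3 = -1 ∧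
    lacunaryCoeff 4 = 1 ∧ lacunaryCoeff 5 = 0 ∧ lacunaryCoeff 6 = -1 := by
  have h1 : lacunaryCoeff 1 = 1 := by rw [lacunaryCoeff_of_odd (by decide)]; norm_num
  have h3 : lacunaryCoeff 3 = -1 := by rw [lacunaryCoeff_of_odd (by decide)]; norm_num
  have h5 : lacunaryCoeff 5 = 0 := by rw [lacunaryCoeff_of_odd (by decide)]; norm_num
  have h2 : lacunaryCoeff 2 = 1 := (lacunaryCoeff_two_mul 1).trans h1
  exact ⟨h1, h2, h3, (lacunaryCoeff_two_mul 2).trans h2, h5, (lacunaryCoeff_two_mul 3).trans h3⟩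

lemma ncard_blockSet_two_mul {n : ℕ} (hn : 3 ≤ n) : ((blockSet (2 * n)).ncard : ℚ) =
    2 * (blockSet n).ncard + 2 * (blockSet (n + 1)).ncard - 8 := by
  have h := ncard_blockSet_add_eight (m := 2 * n) (by omega)
  rw [show (2 * n + 1) / 2 = n by omega, show 2 * n / 2 = n by omega] at h
  have h' : ((blockSet (2 * n)).ncard : ℚ) + 8 = (blockSet n).ncard + (blockSet n).ncard +
      (blockSet (n + 1)).ncard + (blockSet (n + 1)).ncard := by exact_mod_cast h
  linarith

lemma ncard_blockSet_two_mul_add_one {n : ℕ} (hn : 3 ≤ n) : ((blockSet (2 * n + 1)).ncard : ℚ) =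
    (blockSet n).ncard + 2 * (blockSet (n + 1)).ncard + (blockSet (n + 2)).ncard - 8 := by
  have h := ncard_blockSet_add_eight (m := 2 * n + 1) (by omega)
  rw [show (2 * n + 1 + 1) / 2 = n + 1 by omega, show (2 * n + 1) / 2 = n by omega] at h
  have h' : ((blockSet (2 * n + 1)).ncard : ℚ) + 8 = (blockSet (n + 1)).ncard +
      (blockSet n).ncard + (blockSet (n + 1)).ncard + (blockSet (n + 2)).ncard := by
    exact_mod_cast h
  linarith

/-- The coefficient of `z ^ (m + 4)` in `(1 - z ^ 2) * (1 - z) ^ 2 * g z`, where `g` is the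
generating function of the numbers of blocks. -/
noncomputable def blockDifference (m : ℕ) : ℚ :=
  (blockSet (m + 4)).ncard - 2 * (blockSet (m + 3)).ncard + 2 * (blockSet (m + 1)).ncard -
    (blockSet m).ncard

lemma blockDifference_two_mul {n : ℕ} (hn : 3 ≤ n) : blockDifference (2 * n) = 0 := by
  rw [blockDifference, show 2 * n + 4 = 2 * (n + 2) by ring,
    show 2 * n + 3 = 2 * (n + 1) + 1 by ring, ncard_blockSet_two_mul (by omega),
    ncard_blockSet_two_mul (by omega), ncard_blockSet_two_mul_add_one (by omega),
    ncard_blockSet_two_mul_add_one (by omega)]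
  ring_nf

lemma blockDifference_two_mul_add_one {n : ℕ} (hn : 3 ≤ n) :
    blockDifference (2 * n + 1) = blockDifference n := by
  rw [blockDifference, show 2 * n + 1 + 4 = 2 * (n + 2) + 1 by ring,
    show 2 * n + 1 + 3 = 2 * (n + 2) by ring, show 2 * n + 1 + 1 = 2 * (n + 1) by ring,
    ncard_blockSet_two_mul (by omega), ncard_blockSet_two_mul (by omega),
    ncard_blockSet_two_mul_add_one (by omega), ncard_blockSet_two_mul_add_one (by omega),
    blockDifference]
  ring_nf

lemma ncard_blockSet_values : (blockSet 0).ncard = 1 ∧ (blockSet 1).ncard = 2 ∧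
    (blockSet 2).ncard = 4 ∧ (blockSet 3).ncard = 8 :=
  ⟨ncard_blockSet_of_le_three (by norm_num), ncard_blockSet_of_le_three (by norm_num),
    ncard_blockSet_of_le_three (by norm_num), ncard_blockSet_of_le_three (by norm_num)⟩

lemma blockDifference_values : blockDifference 0 = 1 ∧ blockDifference 1 = 3 ∧
    blockDifference 2 = -2 ∧ blockDifference 3 = 1 ∧ blockDifference 4 = 0 ∧
    blockDifference 5 = -1 := by
  obtain ⟨a0, a1, a2, a3⟩ := ncard_blockSet_values
  have a4 := ncard_blockSet_four
  have a5 := ncard_blockSet_five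
  have a6 := ncard_blockSet_add_eight (m := 6) (by norm_num)
  have a7 := ncard_blockSet_add_eight (m := 7) (by norm_num)
  have a8 := ncard_blockSet_add_eight (m := 8) (by norm_num)
  have a9 := ncard_blockSet_add_eight (m := 9) (by norm_num)
  norm_num [a3, a4] at a6
  norm_num [a3, a4, a5] at a7
  norm_num [a4, a5] at a8
  replace a6 : (blockSet 6).ncard = 36 := by omega
  norm_num [a4, a5, a6] at a9
  replace a7 : (blockSet 7).ncard = 53 := by omega
  replace a8 : (blockSet 8).ncard = 70 := by omega
  replace a9 : (blockSet 9).ncard = 92 := by omega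
  norm_num [blockDifference, a0, a1, a2, a3, a4, a5, a6, a7, a8, a9]

/-- For large indices both sides satisfy the same recursion: they vanish at even `m` and take the
value of index `n` at `m = 2 * n + 1`. -/
lemma blockDifference_eq_lacunaryCoeff {m : ℕ} (hm : 3 ≤ m) :
    blockDifference m = lacunaryCoeff (m + 1) := by
  induction m using Nat.strong_induction_on with
  | _ m ih =>
    rcases le_or_gt m 5 with h5 | h5
    · obtain ⟨-, -, -, b3, b4, b5⟩ := blockDifference_values
      obtain ⟨-, -, -, c4, c5, c6⟩ := lacunaryCoeff_values
      interval_cases m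
      exacts [b3.trans c4.symm, b4.trans c5.symm, b5.trans c6.symm]
    · obtain ⟨n, rfl | rfl⟩ := Nat.even_or_odd' m
      · rw [blockDifference_two_mul (by omega), lacunaryCoeff_of_odd (odd_two_mul_add_one n),
          if_neg (by omega), if_neg (by omega), sub_zero]
      · rw [blockDifference_two_mul_add_one (by omega), ih n (by omega) (by omega),
          ← lacunaryCoeff_two_mul, mul_add]

theorem mainTheorem8 :
    Summable (fun i : ℕ =>
      (PowerSeries.X ^ (2 ^ i) - PowerSeries.X ^ (3 * 2 ^ i) : PowerSeries ℚ)) ∧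
    accessibleGenFun (1 + Polynomial.X + Polynomial.X ^ 2) 2 =
      (1 + 2 * PowerSeries.X ^ 3 + 2 * PowerSeries.X ^ 5 - PowerSeries.X ^ 6 +
        PowerSeries.X ^ 3 *
          ∑' i : ℕ, (PowerSeries.X ^ (2 ^ i) - PowerSeries.X ^ (3 * 2 ^ i) : PowerSeries ℚ)) *
      ((1 - PowerSeries.X ^ 2) * (1 - PowerSeries.X) ^ 2)⁻¹ := by
  refine ⟨hasSum_lacunary.summable, ?_⟩
  rw [hasSum_lacunary.tsum_eq, PowerSeries.eq_mul_inv_iff_mul_eq (by simp)]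
  have hD : (1 - PowerSeries.X ^ 2) * (1 - PowerSeries.X) ^ 2 =
      (1 - 2 * PowerSeries.X + 2 * PowerSeries.X ^ 3 - PowerSeries.X ^ 4 : PowerSeries ℚ) := by ring
  have hG : accessibleGenFun (1 + Polynomial.X + Polynomial.X ^ 2) 2 =
      PowerSeries.mk fun m => ((blockSet m).ncard : ℚ) := by
    simp only [accessibleGenFun, accessibleCount_eq]
  rw [hD, hG]
  set G : PowerSeries ℚ := PowerSeries.mk fun m => ((blockSet m).ncard : ℚ)
  have hmul : G * (1 - 2 * PowerSeries.X + 2 * PowerSeries.X ^ 3 - PowerSeries.X ^ 4) =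
      G - PowerSeries.C 2 * (PowerSeries.X ^ 1 * G) + PowerSeries.C 2 * (PowerSeries.X ^ 3 * G) -
        PowerSeries.X ^ 4 * G := by
    rw [map_ofNat]; ring
  have hN :
      (1 + 2 * PowerSeries.X ^ 3 + 2 * PowerSeries.X ^ 5 - PowerSeries.X ^ 6 : PowerSeries ℚ) =
      PowerSeries.X ^ 0 + PowerSeries.C 2 * PowerSeries.X ^ 3 +
        PowerSeries.C 2 * PowerSeries.X ^ 5 - PowerSeries.X ^ 6 := by
    rw [map_ofNat]; ring
  -- Compare coefficients: the first seven by their values, the others by the recursion.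
  rw [hmul, hN]
  obtain ⟨a0, a1, a2, a3⟩ := ncard_blockSet_values
  obtain ⟨b0, b1, b2, -⟩ := blockDifference_values
  obtain ⟨c1, c2, c3, -⟩ := lacunaryCoeff_values
  ext m
  simp only [map_add, map_sub, PowerSeries.coeff_C_mul, PowerSeries.coeff_X_pow_mul',
    PowerSeries.coeff_X_pow, PowerSeries.coeff_mk, G]
  rcases le_or_gt m 6 with hm | hm
  · interval_cases m
    · norm_num [a0]
    · norm_num [a0, a1]
    · norm_num [a1, a2]
    · norm_num [a0, a2, a3, lacunaryCoeff_zero]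
    · norm_num [c1]; norm_num [blockDifference] at b0; linarith
    · norm_num [c2]; norm_num [blockDifference] at b1; linarith
    · norm_num [c3]; norm_num [blockDifference] at b2; linarith
  · obtain ⟨n, rfl⟩ : ∃ n, m = n + 4 := ⟨m - 4, by omega⟩
    have h := blockDifference_eq_lacunaryCoeff (m := n) (by omega)
    rw [blockDifference] at h
    rw [if_pos (by omega), if_pos (by omega), if_pos (by omega), if_neg (by omega),
      if_neg (by omega), if_neg (by omega), if_neg (by omega), if_pos (by omega),
      show n + 4 - 1 = n + 3 by omega, show n + 4 - 3 = n + 1 by omega,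
      show n + 4 - 4 = n by omega, ← h]
    ring
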